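/- Let $G$ be a finitely generated group, let $d\ge 1$, and let $\mathcal A=M_d(\mathbb C)^{\otimes G}$ be the spin (UHF) $C^*$-algebra over $G$, with its local subalgebras $\mathcal S_\Lambda\cong M_d(\mathbb C)^{\otimes\Lambda}$ for finite $\Lambda\subseteq G$. A \emph{frustration-free system of projections} is a family of projections $p_\Lambda\in\mathcal S_\Lambda$, indexed by the finite subsets $\Lambda$ of $G$, with $p_{\Lambda_1}p_{\Lambda_2}=p_{\Lambda_2}p_{\Lambda_1}=p_{\Lambda_1}$ whenever $\Lambda_1\subseteq\Lambda_2$; it is \emph{proper} if $p_\Lambda<1$ for all $\Lambda$. A \emph{frustration-free ground state} of $\{p_\Lambda\}$ is a state $\omega$ of $\mathcal A$ with $\omega(p_\Lambda)=0$ for all $\Lambda$. For a state $\omega$ put $\mathcal N_\omega=\{a\in\mathcal A:\omega(a^*a)=0\}$ and $\mathcal B_\omega=\mathcal N_\omega^*\cap\mathcal N_\omega$. For a hereditary $C^*$-subalgebra $\mathcal B$ of $\mathcal A$ let $\mathfrak j(\mathcal B)$ be the set of pure states $\psi$ of $\mathcal A$ with $\mathcal B\subseteq\mathcal B_\psi$,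 and call $\mathfrak s(\omega)=\mathfrak j(\mathcal B_\omega)$ the support of $\omega$. Let $\{p_\Lambda\}$ be a proper frustration-free system of projections, let $\Lambda_1\subseteq\Lambda_2\subseteq\cdots$ be any increasing sequence of finite subsets of $G$ with $\bigcup_m\Lambda_m=G$, and put $$w=\sum_{m=1}^\infty 2^{-m}p_{\Lambda_m},\qquad \mathfrak p^{-1}(\{p_\Lambda\})=\overline{w\mathcal A w}.$$ Then $\mathfrak p^{-1}(\{p_\Lambda\})$ is a proper hereditary $C^*$-subalgebra of $\mathcal A$, and $$\mathfrak p^{-1}(\{p_\Lambda\})=\bigcap_{\omega}\mathcal B_\omega ,\qquad \mathfrak j\big(\mathfrak p^{-1}(\{p_\Lambda\})\big)=\bigcup_{\omega}\mathfrak s(\omega),$$ where $\omega$ runs over all frustration-free ground states of $\{p_\Lambda\}$. (In particular $\mathfrak p^{-1}(\{p_\Lambda\})$ does not depend on the sequence $(\Lambda_m)$.) The second equality remains valid if the union is restricted to the pure frustration-free ground states. -/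

import Mathlib

open scoped ComplexOrder

noncomputable section

/-! ### States, left kernels and hereditary subalgebras of a unital C*-algebra -/

section CStar

variable (A : Type*) [CStarAlgebra A] [PartialOrder A]

/-- The states of `A`: positive normalised (continuous) linear functionals. -/
def stateSpace : Set (StrongDual ℂ A) :=
  {φ | (∀ a : A, 0 ≤ a → 0 ≤ φ a) ∧ φ 1 = 1}

/-- The pure states of `A`: the extreme points of the state space. -/
def pureStates : Set (StrongDual ℂ A) :=
  Set.extremePoints ℝ (stateSpace A)

variable {A}

theorem pureStates_subset_stateSpace : pureStates A ⊆ stateSpace A :=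
  extremePoints_subset

variable [StarOrderedRing A]

/-- For a state `ω`, the left ideal `N_ω = {a | ω (a* a) = 0}`. -/
def leftKernel (ω : stateSpace A) : Ideal A where
  carrier := {a | ω.1 (star a * a) = 0}
  zero_mem' := by simp
  add_mem' := by
    intro a b ha hb
    simp only [Set.mem_ofPred_eq] at ha hb ⊢
    have h1 : 0 ≤ ω.1 (star (a + b) * (a + b)) := ω.2.1 _ (star_mul_self_nonneg _)
    have h2 : 0 ≤ ω.1 (star (a - b) * (a - b)) := ω.2.1 _ (star_mul_self_nonneg _)
    have h3 : ω.1 (star (a + b) * (a + b)) + ω.1 (star (a - b) * (a - b)) = 0 := by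
      rw [← map_add]
      have : star (a + b) * (a + b) + star (a - b) * (a - b)
          = (2 : ℂ) • (star a * a) + (2 : ℂ) • (star b * b) := by
        simp only [star_add, star_sub, two_smul]
        noncomm_ring
      rw [this, map_add, map_smul, map_smul, ha, hb]
      simp
    exact ((add_eq_zero_iff_of_nonneg h1 h2).1 h3).1
  smul_mem' := by
    intro c a ha
    simp only [Set.mem_ofPred_eq, smul_eq_mul] at ha ⊢
    refine le_antisymm ?_ (ω.2.1 _ (star_mul_self_nonneg _))
    have hle : star a * (star c * c) * a ≤ ‖star c * c‖ • (star a * a) :=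
      CStarAlgebra.star_left_conjugate_le_norm_smul
    have h1 := ω.2.1 _ (sub_nonneg.2 hle)
    have h2 : ω.1 (‖star c * c‖ • (star a * a)) = 0 := by
      rw [← Complex.coe_smul, map_smul, ha, smul_zero]
    rw [map_sub, h2, zero_sub] at h1
    have h3 : star (c * a) * (c * a) = star a * (star c * c) * a := by
      simp [mul_assoc]
    rw [h3]
    exact neg_nonneg.1 h1

/-- For a state `ω`, the subalgebra `B_ω = N_ω* ∩ N_ω`. -/
def stateHereditary (ω : stateSpace A) : NonUnitalStarSubalgebra ℂ A where
  carrier := {a | star a ∈ leftKernel ω ∧ a ∈ leftKernel ω}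
  zero_mem' := by simp
  add_mem' := fun ha hb => by
    refine ⟨?_, add_mem ha.2 hb.2⟩
    rw [star_add]
    exact add_mem ha.1 hb.1
  mul_mem' := fun {a b} ha hb => by
    refine ⟨?_, (leftKernel ω).mul_mem_left a hb.2⟩
    rw [star_mul]
    exact (leftKernel ω).mul_mem_left _ ha.1
  smul_mem' := fun c a ha => by
    refine ⟨?_, ?_⟩
    · rw [star_smul, ← smul_one_mul (star c) (star a)]
      exact (leftKernel ω).mul_mem_left _ ha.1
    · rw [← smul_one_mul c a]
      exact (leftKernel ω).mul_mem_left _ ha.2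
  star_mem' := fun {a} ha => by
    refine ⟨?_, ha.1⟩
    rw [star_star]
    exact ha.2

/-- `B` is a hereditary C*-subalgebra: it is norm closed, and `0 ≤ a ≤ b` with `b ∈ B` forces
`a ∈ B`. -/
def IsHereditaryCStarSubalgebra (B : NonUnitalStarSubalgebra ℂ A) : Prop :=
  IsClosed (B : Set A) ∧ ∀ a b : A, 0 ≤ a → a ≤ b → b ∈ B → a ∈ B

/-- The set of pure states associated with a subalgebra `B`:
the pure states `ψ` with `B ⊆ B_ψ`. -/
def pureStatesOf (B : NonUnitalStarSubalgebra ℂ A) : Set (StrongDual ℂ A) :=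
  {ψ | ∃ hψ : ψ ∈ pureStates A, B ≤ stateHereditary ⟨ψ, pureStates_subset_stateSpace hψ⟩}

/-- The support of a state `ω` in the space of pure states. -/
def stateSupport (ω : stateSpace A) : Set (StrongDual ℂ A) :=
  pureStatesOf (stateHereditary ω)

/-- The norm closure of `w A w`, for a self-adjoint element `w`. -/
def cornerClosure (w : A) (hw : IsSelfAdjoint w) : NonUnitalStarSubalgebra ℂ A :=
  NonUnitalStarSubalgebra.topologicalClosure
    { carrier := {b | ∃ a : A, b = w * a * w}
      zero_mem' := ⟨0, by simp⟩
      add_mem' := by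
        rintro _ _ ⟨a, rfl⟩ ⟨b, rfl⟩
        exact ⟨a + b, by noncomm_ring⟩
      mul_mem' := by
        rintro _ _ ⟨a, rfl⟩ ⟨b, rfl⟩
        exact ⟨a * w * (w * b), by noncomm_ring⟩
      smul_mem' := by
        rintro c _ ⟨a, rfl⟩
        exact ⟨c • a, by simp⟩
      star_mem' := by
        rintro _ ⟨a, rfl⟩
        exact ⟨star a, by simp [hw.star_eq, mul_assoc]⟩ }

end CStar

/-! ### The spin algebra `M_d(ℂ)^{⊗ G}`

It is realised concretely on the Hilbert space `ℓ²({1, …, d}^G)` of square-summable functions of the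
spin configurations, as the C*-algebra generated by the matrices acting on single sites. -/

section SpinAlgebra

variable (G : Type*) (d : ℕ)

/-- The Hilbert space `ℓ²({1, …, d}^G)`. -/
abbrev SpinHilbert : Type _ := lp (fun _ : G → Fin d => ℂ) 2

variable {G d}

open Classical in
/-- The formula for the action of a matrix `M` on the spin at the site `g`:
`(M ψ)(c) = ∑ k, M (c g) k * ψ (c with its value at g replaced by k)`. -/
def siteFun (g : G) (M : Matrix (Fin d) (Fin d) ℂ) (ψ : (G → Fin d) → ℂ) (c : G → Fin d) : ℂ :=
  ∑ k, M (c g) k * ψ (Function.update c g k)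

open Classical in
theorem summable_update (g : G) (f : (G → Fin d) → ℝ) (hf : 0 ≤ f) (h1 : Summable f)
    (k : Fin d) : Summable fun c : G → Fin d => f (Function.update c g k) := by
  have h2 : Summable fun x : Fin d × (G → Fin d) => f x.2 := by
    rw [summable_prod_of_nonneg (fun x => hf x.2)]
    exact ⟨fun _ => h1, (hasSum_fintype _).summable⟩
  have hinj : Function.Injective
      fun c : G → Fin d => (c g, Function.update c g k) := by
    intro c c' h
    simp only [Prod.mk.injEq] at h
    funext x
    by_cases hx : x = g
    · rw [hx, h.1]
    · simpa [hx] using congrFun h.2 x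
  exact h2.comp_injective hinj

theorem memℓp_siteFun (g : G) (M : Matrix (Fin d) (Fin d) ℂ) (ψ : SpinHilbert G d) :
    Memℓp (siteFun g M ψ) 2 := by
  classical
  have key : ∀ (k : Fin d),
      Memℓp (fun c : G → Fin d => M (c g) k * ψ (Function.update c g k)) 2 := by
    intro k
    apply memℓp_gen
    have h0 : Summable fun c : G → Fin d => ‖ψ c‖ ^ 2 := by
      simpa using (lp.memℓp ψ).summable (by norm_num)
    have h := (summable_update g (fun c => ‖ψ c‖ ^ 2) (fun _ => by positivity) h0 k).mul_left
      (∑ i, ‖M i k‖ ^ 2)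
    refine Summable.of_nonneg_of_le (fun _ => by positivity) (fun c => ?_) h
    simp only [ENNReal.toReal_ofNat, Real.rpow_ofNat, norm_mul, mul_pow]
    gcongr
    exact Finset.single_le_sum (f := fun i => ‖M i k‖ ^ 2) (fun _ _ => by positivity)
      (Finset.mem_univ (c g))
  have := Memℓp.finsetSum Finset.univ (f := fun k : Fin d => 
      fun c : G → Fin d => M (c g) k * ψ (Function.update c g k)) (fun k _ => key k)
  exact this

/-- The linear operator of a matrix at the site `g`. -/
def siteLinear (g : G) (M : Matrix (Fin d) (Fin d) ℂ) : SpinHilbert G d →ₗ[ℂ] SpinHilbert G d where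
  toFun ψ := ⟨siteFun g M ψ, memℓp_siteFun g M ψ⟩
  map_add' ψ φ := by
    ext c
    change siteFun g M (⇑(ψ + φ)) c = siteFun g M ψ c + siteFun g M φ c
    simp [siteFun, mul_add, Finset.sum_add_distrib]
  map_smul' z ψ := by
    ext c
    change siteFun g M (⇑(z • ψ)) c = z * siteFun g M ψ c
    simp [siteFun, Finset.mul_sum, mul_left_comm]

theorem tendsto_coord {u : ℕ → SpinHilbert G d} {x : SpinHilbert G d}
    (h : Filter.Tendsto u Filter.atTop (nhds x)) (c : G → Fin d) :
    Filter.Tendsto (fun n => u n c) Filter.atTop (nhds (x c)) := by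
  rw [tendsto_iff_norm_sub_tendsto_zero] at h ⊢
  refine squeeze_zero (fun _ => norm_nonneg _) (fun n => ?_) h
  simpa using lp.norm_apply_le_norm (by norm_num) (u n - x) c

theorem continuous_siteLinear (g : G) (M : Matrix (Fin d) (Fin d) ℂ) :
    Continuous (siteLinear g M) := by
  classical
  refine (siteLinear g M).continuous_of_seq_closed_graph fun u x y hu hTu => ?_
  ext c
  refine tendsto_nhds_unique (tendsto_coord hTu c) ?_
  change Filter.Tendsto (fun n => siteFun g M (u n) c) Filter.atTop (nhds (siteFun g M x c))
  exact tendsto_finsetSum _ fun k _ => (tendsto_coord hu (Function.update c g k)).const_mul _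

/-- The bounded operator of a matrix at the site `g`. -/
def siteOp (g : G) (M : Matrix (Fin d) (Fin d) ℂ) : SpinHilbert G d →L[ℂ] SpinHilbert G d :=
  ⟨siteLinear g M, continuous_siteLinear g M⟩

theorem siteOp_apply (g : G) (M : Matrix (Fin d) (Fin d) ℂ) (ψ : SpinHilbert G d)
    (c : G → Fin d) : siteOp g M ψ c = siteFun g M ψ c := rfl

open Classical in
theorem siteOp_adjoint (g : G) (M : Matrix (Fin d) (Fin d) ℂ) :
    siteOp g (star M) = star (siteOp g M) := by
  rw [ContinuousLinearMap.star_eq_adjoint, ContinuousLinearMap.eq_adjoint_iff]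
  intro x y
  -- both sides are sums over configurations `c` and values `k`, exchanged by the involution
  -- `(c, k) ↦ (c with its value at g replaced by k, c g)`
  have hsx : Summable fun c : G → Fin d => ‖x c‖ ^ 2 := by
    simpa using (lp.memℓp x).summable (by norm_num)
  have hsy : Summable fun c : G → Fin d => ‖y c‖ ^ 2 := by
    simpa using (lp.memℓp y).summable (by norm_num)
  let F : (G → Fin d) × Fin d → ℂ := fun p =>
    star (star (M p.2 (p.1 g)) * x (Function.update p.1 g p.2)) * y p.1
  let F' : (G → Fin d) × Fin d → ℂ := fun p =>
    star (x p.1) * (M (p.1 g) p.2 * y (Function.update p.1 g p.2))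
  let e : (G → Fin d) × Fin d ≃ (G → Fin d) × Fin d :=
    { toFun := fun p => (Function.update p.1 g p.2, p.1 g)
      invFun := fun p => (Function.update p.1 g p.2, p.1 g)
      left_inv := fun p => by simp
      right_inv := fun p => by simp }
  have hFe : ∀ p, F' (e p) = F p := fun p => by
    simp only [F, F', e, Equiv.coe_fn_mk, Function.update_self, Function.update_idem,
      Function.update_eq_self, star_mul', star_star]
    ring
  have hF : Summable F := by
    rw [← summable_norm_iff, summable_prod_of_nonneg (fun _ => norm_nonneg _)]
    refine ⟨fun _ => (hasSum_fintype _).summable, ?_⟩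
    simp only [tsum_fintype]
    refine summable_sum fun k _ => ?_
    have h1 := ((summable_update g (fun c => ‖x c‖ ^ 2) (fun _ => by positivity) hsx k).add
      hsy).mul_left (∑ i, ‖M k i‖)
    refine Summable.of_nonneg_of_le (fun _ => norm_nonneg _) (fun c => ?_) h1
    have h2 : ‖M k (c g)‖ ≤ ∑ i, ‖M k i‖ :=
      Finset.single_le_sum (f := fun i => ‖M k i‖) (fun _ _ => by positivity)
        (Finset.mem_univ (c g))
    have h3 : ‖x (Function.update c g k)‖ * ‖y c‖
        ≤ ‖x (Function.update c g k)‖ ^ 2 + ‖y c‖ ^ 2 := by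
      nlinarith [sq_nonneg (‖x (Function.update c g k)‖ - ‖y c‖),
        sq_nonneg (‖x (Function.update c g k)‖), sq_nonneg (‖y c‖)]
    calc ‖F (c, k)‖ = ‖M k (c g)‖ * (‖x (Function.update c g k)‖ * ‖y c‖) := by
          simp [F, mul_assoc]
      _ ≤ _ := by gcongr
  have hF' : Summable F' := by
    rw [← e.summable_iff]
    exact hF.congr fun p => (hFe p).symm
  have hl : inner ℂ (siteOp g (star M) x) y = ∑' p, F p := by
    rw [lp.inner_eq_tsum, hF.tsum_prod]
    refine tsum_congr fun c => ?_
    rw [tsum_fintype, siteOp_apply]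
    simp only [RCLike.inner_apply', siteFun, F, Matrix.star_apply, map_sum, Finset.sum_mul]
    rfl
  have hr : inner ℂ x (siteOp g M y) = ∑' p, F' p := by
    rw [lp.inner_eq_tsum, hF'.tsum_prod]
    refine tsum_congr fun c => ?_
    rw [tsum_fintype, siteOp_apply]
    simp only [RCLike.inner_apply', siteFun, F', Finset.mul_sum]
    rfl
  rw [hl, hr, ← e.tsum_eq F']
  exact tsum_congr fun p => (hFe p).symm

/-- The embedding of the site algebra `M_d(ℂ)` at the site `g`. -/
def siteHom (g : G) :
    Matrix (Fin d) (Fin d) ℂ →⋆ₐ[ℂ] (SpinHilbert G d →L[ℂ] SpinHilbert G d) where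
  toFun := siteOp g
  map_one' := by
    classical
    ext ψ c
    simp [siteOp_apply, siteFun, Matrix.one_apply]
  map_mul' M N := by
    classical
    ext ψ c
    change siteFun g (M * N) ψ c = siteFun g M (siteFun g N ψ) c
    simp only [siteFun, Matrix.mul_apply, Function.update_self, Function.update_idem,
      Finset.mul_sum, Finset.sum_mul]
    rw [Finset.sum_comm]
    simp [mul_assoc]
  map_zero' := by
    ext ψ c
    simp [siteOp_apply, siteFun]
  map_add' M N := by
    ext ψ c
    simp [siteOp_apply, siteFun, add_mul, Finset.sum_add_distrib]
  commutes' z := by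
    classical
    ext ψ c
    change siteFun g (algebraMap ℂ (Matrix (Fin d) (Fin d) ℂ) z) ψ c = z * ψ c
    simp [siteFun, Matrix.algebraMap_matrix_apply]
  map_star' M := siteOp_adjoint g M

variable (G d)

/-- The C*-algebra of operators generated by all site algebras. -/
def spinStarSubalgebra : StarSubalgebra ℂ (SpinHilbert G d →L[ℂ] SpinHilbert G d) :=
  (⨆ g : G, (siteHom (d := d) g).range).topologicalClosure

/-- The spin algebra `M_d(ℂ)^{⊗ G}`, as a C*-algebra with its usual order. -/
def SpinAlgebra : Type _ := spinStarSubalgebra G d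

instance : CStarAlgebra (SpinAlgebra G d) :=
  StarSubalgebra.cstarAlgebra (spinStarSubalgebra G d)
    (h_closed := StarSubalgebra.isClosed_topologicalClosure _)

instance : PartialOrder (SpinAlgebra G d) := CStarAlgebra.spectralOrder _

instance : StarOrderedRing (SpinAlgebra G d) := CStarAlgebra.spectralOrderedRing _

variable {G d}

/-- The embedding of the site algebra at `g` into the spin algebra. -/
def siteEmbedding (g : G) : Matrix (Fin d) (Fin d) ℂ →⋆ₐ[ℂ] SpinAlgebra G d :=
  (siteHom g).codRestrict (spinStarSubalgebra G d) fun M =>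
    StarSubalgebra.le_topologicalClosure _
      (le_iSup (fun g : G => (siteHom (d := d) g).range) g ⟨M, rfl⟩)

/-- The local algebra `S_Λ ≅ M_d(ℂ)^{⊗ Λ}`, generated by the site algebras at the sites of `Λ`. -/
def localAlgebra (Λ : Finset G) : StarSubalgebra ℂ (SpinAlgebra G d) :=
  ⨆ g ∈ Λ, (siteEmbedding g).range

end SpinAlgebra

/-! ### Frustration-free systems of projections -/

section FrustrationFree

variable (G : Type*) (d : ℕ)

/-- A frustration-free system of projections `p_Λ ∈ S_Λ`, indexed by the finite subsets of `G`. -/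
structure FrustrationFreeSystem where
  /-- The projection `p_Λ`. -/
  proj : Finset G → SpinAlgebra G d
  isStarProjection : ∀ Λ, IsStarProjection (proj Λ)
  mem_localAlgebra : ∀ Λ, proj Λ ∈ localAlgebra Λ
  mul_left_eq : ∀ Λ₁ Λ₂, Λ₁ ⊆ Λ₂ → proj Λ₁ * proj Λ₂ = proj Λ₁
  mul_right_eq : ∀ Λ₁ Λ₂, Λ₁ ⊆ Λ₂ → proj Λ₂ * proj Λ₁ = proj Λ₁

namespace FrustrationFreeSystem

variable {G d}

/-- The system is proper if `p_Λ < 1` for all `Λ`. -/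
def IsProper (p : FrustrationFreeSystem G d) : Prop :=
  ∀ Λ, p.proj Λ < 1

/-- The frustration-free ground states of the system. -/
def groundStates (p : FrustrationFreeSystem G d) : Set (stateSpace (SpinAlgebra G d)) :=
  {ω | ∀ Λ, ω.1 (p.proj Λ) = 0}

/-- The element `w = ∑_{m ≥ 1} 2^{-m} p_{Λ_m}` of a sequence of finite sets (whose members are
numbered here from `0`). -/
def weight (p : FrustrationFreeSystem G d) (Λ : ℕ → Finset G) : SpinAlgebra G d :=
  ∑' m : ℕ, ((1 / 2 : ℝ) ^ (m + 1)) • p.proj (Λ m)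

theorem isSelfAdjoint_weight (p : FrustrationFreeSystem G d) (Λ : ℕ → Finset G) :
    IsSelfAdjoint (p.weight Λ) := by
  rw [IsSelfAdjoint, weight, tsum_star]
  refine tsum_congr fun m => ?_
  rw [star_smul, (p.isStarProjection (Λ m)).isSelfAdjoint.star_eq, star_trivial]

/-- The hereditary subalgebra of the system, the norm closure of `w A w`, formed with a sequence of
finite sets. -/
def hereditary (p : FrustrationFreeSystem G d) (Λ : ℕ → Finset G) :
    NonUnitalStarSubalgebra ℂ (SpinAlgebra G d) :=
  cornerClosure (p.weight Λ) (p.isSelfAdjoint_weight Λ)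

end FrustrationFreeSystem

end FrustrationFree

end

/-!
The argument is about an arbitrary unital C*-algebra `A` and a positive element `w` of it; the
frustration-free system enters only through two facts about `w = ∑ 2^{-m} p_{Λ_m}`: a state is a
ground state if and only if it vanishes at `w`, and `w` is not right invertible.

The core is `cornerClosure_eq_iInter`: the closure of `w A w` is the intersection of the `B_ω` over
the states `ω` with `ω(w) = 0`. One inclusion is immediate, because such an `ω` satisfies
`w ∈ N_ω`. For the other, let `a` lie in every such `B_ω`. Then every state that vanishes at `w`
vanishes at `a* a`, and Hahn–Banach separation from the convex cone generated by `w` and the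
negative elements (`exists_le_smul_one_add_smul`) gives, for each `ε > 0`, a bound
`a* a ≤ ε + n w`. Conjugating with `u = δ (w + δ)⁻¹`, for which `‖u w u‖ ≤ δ`, shows that `a u` is
small when `δ` is small compared with `1 / n`. The same applies to `a*`, so `a` is close to
`(1 - u) a (1 - u)`, and this is in `w A w` since `1 - u = w (w + δ)⁻¹`.

Each `B_ω` is closed under passing to smaller positive elements, hence so is the intersection.
The subalgebra is proper: if `1` were in the closure of `w A w`, then `w c = 1` for some `c`, while
`‖(1 - p_{Λ_m}) w‖ → 0` and the `1 - p_{Λ_m}` are nonzero projections, of norm `1`. Finally, the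
`p_Λ` lie in all `B_ω` of ground states, hence in the hereditary subalgebra; so a pure
state `ψ` with the hereditary subalgebra inside `B_ψ` is itself a ground state, and it is in its own
support. This gives both descriptions of the associated set of pure states.
-/

/-! ### States and their left kernels -/

section LeftKernel

variable {A : Type*} [CStarAlgebra A] [PartialOrder A] [StarOrderedRing A]

theorem mem_leftKernel {ω : stateSpace A} {a : A} :
    a ∈ leftKernel ω ↔ ω.1 (star a * a) = 0 := Iff.rfl

theorem mem_stateHereditary {ω : stateSpace A} {a : A} :
    a ∈ stateHereditary ω ↔ star a ∈ leftKernel ω ∧ a ∈ leftKernel ω := Iff.rfl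

theorem isClosed_leftKernel (ω : stateSpace A) : IsClosed (leftKernel ω : Set A) :=
  isClosed_eq (f := fun a : A => ω.1 (star a * a)) (by fun_prop) continuous_const

theorem isClosed_stateHereditary (ω : stateSpace A) : IsClosed (stateHereditary ω : Set A) :=
  ((isClosed_leftKernel ω).preimage continuous_star).inter (isClosed_leftKernel ω)

theorem mem_leftKernel_of_nonneg {ω : stateSpace A} {a : A} (ha : 0 ≤ a) (h : ω.1 a = 0) :
    a ∈ leftKernel ω := by
  have hs : CFC.sqrt a ∈ leftKernel ω := by
    rw [mem_leftKernel, (IsSelfAdjoint.of_nonneg (CFC.sqrt_nonneg a)).star_eq,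
      CFC.sqrt_mul_sqrt_self a ha, h]
  rw [← CFC.sqrt_mul_sqrt_self a ha]
  exact (leftKernel ω).mul_mem_left _ hs

/-- A case of the Cauchy–Schwarz inequality, `ω(a)² ≤ ω(1) ω(a²)`. -/
theorem apply_eq_zero_of_mem_leftKernel {ω : stateSpace A} {a : A} (ha : 0 ≤ a)
    (h : a ∈ leftKernel ω) : ω.1 a = 0 := by
  have hsa : star a = a := (IsSelfAdjoint.of_nonneg ha).star_eq
  have h0 : 0 ≤ ω.1 a := ω.2.1 a ha
  obtain ⟨t, ht⟩ : ∃ t : ℝ, ω.1 a = (t : ℂ) := ⟨_, (Complex.eq_re_of_ofReal_le h0)⟩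
  have h1 := ω.2.1 _ (star_mul_self_nonneg (a - (t : ℂ) • (1 : A)))
  have h2 : star (a - (t : ℂ) • (1 : A)) * (a - (t : ℂ) • (1 : A))
      = star a * a - (2 * t : ℂ) • a + ((t : ℂ) * t) • (1 : A) := by
    simp only [star_sub, star_smul, star_one, hsa, Complex.star_def, Complex.conj_ofReal, sub_mul,
      mul_sub, smul_mul_assoc, mul_smul_comm, one_mul, mul_one]
    module
  rw [h2, map_add, map_sub, map_smul, map_smul, mem_leftKernel.1 h, ω.2.2, ht] at h1
  have h3 : (0 : ℝ) ≤ -(t * t) := by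
    have : (0 : ℂ) ≤ ((-(t * t) : ℝ) : ℂ) := by
      convert h1 using 1
      push_cast
      simp only [smul_eq_mul]
      ring
    exact_mod_cast this
  have h4 : t = 0 := by nlinarith
  rw [ht, h4, Complex.ofReal_zero]

theorem mem_stateHereditary_iff_of_nonneg {ω : stateSpace A} {a : A} (ha : 0 ≤ a) :
    a ∈ stateHereditary ω ↔ ω.1 a = 0 := by
  rw [mem_stateHereditary, (IsSelfAdjoint.of_nonneg ha).star_eq, and_self]
  exact ⟨apply_eq_zero_of_mem_leftKernel ha, mem_leftKernel_of_nonneg ha⟩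

theorem apply_eq_zero_of_le {ω : stateSpace A} {a b : A} (ha : 0 ≤ a) (hab : a ≤ b)
    (hb : ω.1 b = 0) : ω.1 a = 0 := by
  have h := ω.2.1 _ (sub_nonneg.2 hab)
  rw [map_sub, hb, zero_sub] at h
  exact le_antisymm (neg_nonneg.1 h) (ω.2.1 a ha)

theorem isHereditaryCStarSubalgebra_stateHereditary (ω : stateSpace A) :
    IsHereditaryCStarSubalgebra (stateHereditary ω) := by
  refine ⟨isClosed_stateHereditary ω, fun a b ha hab hb => ?_⟩
  rw [mem_stateHereditary_iff_of_nonneg ha]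
  exact apply_eq_zero_of_le ha hab ((mem_stateHereditary_iff_of_nonneg (ha.trans hab)).1 hb)

/-- If every state vanishing at `w` vanishes at `h`, then `h` is dominated, up to `ε`, by a multiple
of `w`. This is Hahn–Banach separation of `h` from the cone of the elements whose real part is below
a multiple of `w`. -/
theorem exists_le_smul_one_add_smul {w h : A} (hw : 0 ≤ w) (hh : IsSelfAdjoint h)
    (H : ∀ ω : stateSpace A, ω.1 w = 0 → ω.1 h = 0) {ε : ℝ} (hε : 0 < ε) :
    ∃ n : ℝ, 0 ≤ n ∧ h ≤ ε • (1 : A) + n • w := by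
  let C : Set A := {x | ∃ n : ℝ, 0 ≤ n ∧ (realPart x : A) ≤ n • w}
  have hC0 : (0 : A) ∈ C := ⟨0, le_rfl, by simp⟩
  have hCconv : Convex ℝ C := by
    rintro x ⟨m, hm, hx⟩ y ⟨n, hn, hy⟩ s t hs ht _
    refine ⟨s * m + t * n, by positivity, ?_⟩
    rw [map_add, map_smul, map_smul, add_smul, mul_smul, mul_smul]
    push_cast
    exact add_le_add (smul_le_smul_of_nonneg_left hx hs) (smul_le_smul_of_nonneg_left hy ht)
  have hCcone : ∀ x ∈ C, ∀ s : ℝ, 0 ≤ s → s • x ∈ C := by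
    rintro x ⟨m, hm, hx⟩ s hs
    refine ⟨s * m, by positivity, ?_⟩
    rw [map_smul, mul_smul]
    exact smul_le_smul_of_nonneg_left hx hs
  by_cases hcl : h ∈ closure C
  · obtain ⟨x, ⟨n, hn, hx⟩, hd⟩ := Metric.mem_closure_iff.1 hcl ε hε
    refine ⟨n, hn, ?_⟩
    have h1 : h - realPart x ≤ ε • (1 : A) := by
      have h2 : h - realPart x = (realPart (h - x) : A) := by
        rw [map_sub, AddSubgroup.coe_sub, hh.coe_realPart]
      have h3 : ‖(realPart (h - x) : A)‖ ≤ ε :=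
        (realPart.norm_le (h - x)).trans (by rw [← dist_eq_norm]; exact hd.le)
      rw [h2]
      calc (realPart (h - x) : A) ≤ algebraMap ℝ A ‖(realPart (h - x) : A)‖ :=
            (realPart (h - x)).2.le_algebraMap_norm_self
        _ = ‖(realPart (h - x) : A)‖ • (1 : A) := Algebra.algebraMap_eq_smul_one _
        _ ≤ ε • (1 : A) := smul_le_smul_of_nonneg_right h3 zero_le_one
    calc h = (h - realPart x) + realPart x := by abel
      _ ≤ _ := add_le_add h1 hx
  · -- otherwise the normalised separating functional is a state that vanishes at `w` but not at `h`
    exfalso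
    obtain ⟨f, v, hf, hv⟩ := RCLike.geometric_hahn_banach_closed_point (𝕜 := ℂ) hCconv.closure
      isClosed_closure hcl
    simp only [RCLike.re_eq_complex_re] at hf hv
    have hv0 : 0 < v := by simpa using hf 0 (subset_closure hC0)
    have hneg : ∀ x ∈ C, (f x).re ≤ 0 := by
      intro x hx
      by_contra! hpos
      have h1 := hf _ (subset_closure (hCcone x hx (v / (f x).re) (by positivity)))
      rw [← Complex.coe_smul, map_smul, smul_eq_mul, Complex.re_ofReal_mul,
        div_mul_cancel₀ _ hpos.ne'] at h1
      exact lt_irrefl _ h1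
    -- purely imaginary multiples of a self-adjoint element have real part `0`, so they are in `C`
    have him_eq_zero : ∀ x : A, IsSelfAdjoint x → (f x).im = 0 := by
      intro x hx
      have hmem : ∀ z : ℂ, z.re = 0 → z • x ∈ C := by
        intro z hz
        refine ⟨0, le_rfl, ?_⟩
        rw [realPart_smul, hz, hx.imaginaryPart]
        simp
      have h1 := hneg _ (hmem Complex.I (by simp))
      have h2 := hneg _ (hmem (-Complex.I) (by simp))
      rw [map_smul, smul_eq_mul] at h1 h2
      simp at h1 h2
      linarith
    have hpos : ∀ x : A, 0 ≤ x → 0 ≤ f x := by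
      intro x hx
      have hmem : -x ∈ C := by
        refine ⟨0, le_rfl, ?_⟩
        rw [map_neg, AddSubgroup.coe_neg, (IsSelfAdjoint.of_nonneg hx).coe_realPart]
        simpa using hx
      have h1 := hneg _ hmem
      rw [map_neg, Complex.neg_re] at h1
      exact Complex.nonneg_iff.2 ⟨by linarith, (him_eq_zero x (.of_nonneg hx)).symm⟩
    have hfw : f w = 0 := by
      refine le_antisymm ?_ (hpos w hw)
      have h1 : (f w).re ≤ 0 := hneg w ⟨1, zero_le_one, by
        rw [(IsSelfAdjoint.of_nonneg hw).coe_realPart, one_smul]⟩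
      exact Complex.nonpos_iff.2 ⟨h1, him_eq_zero w (.of_nonneg hw)⟩
    have hfh : f h ≠ 0 := by
      intro h0
      rw [h0, Complex.zero_re] at hv
      linarith
    have hf1 : f 1 ≠ 0 := by
      intro h1
      have h2 := hpos _ (sub_nonneg.2 hh.le_algebraMap_norm_self)
      rw [Algebra.algebraMap_eq_smul_one, map_sub, ← Complex.coe_smul, map_smul, h1, smul_zero,
        zero_sub] at h2
      have h3 := (Complex.nonneg_iff.1 h2).1
      rw [Complex.neg_re] at h3
      linarith
    have hf1' : 0 ≤ (f 1)⁻¹ := inv_nonneg.2 (hpos 1 zero_le_one)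
    let ω : stateSpace A := ⟨(f 1)⁻¹ • f, fun a ha => mul_nonneg hf1' (hpos a ha),
      inv_mul_cancel₀ hf1⟩
    have h1 : (f 1)⁻¹ * f h = 0 := H ω (by
      change (f 1)⁻¹ * f w = 0
      rw [hfw, mul_zero])
    exact (mul_ne_zero (inv_ne_zero hf1) hfh) h1

end LeftKernel

/-! ### The closure of `w A w` as an intersection over states -/

section Corner

variable {A : Type*} [CStarAlgebra A]

theorem mem_cornerClosure {w : A} {hw : IsSelfAdjoint w} {x : A} :
    x ∈ cornerClosure w hw ↔ x ∈ closure {b | ∃ a : A, b = w * a * w} := Iff.rfl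

theorem exists_mul_eq_one_of_one_mem_cornerClosure {w : A} {hsa : IsSelfAdjoint w}
    (h : 1 ∈ cornerClosure w hsa) : ∃ c : A, w * c = 1 := by
  rw [mem_cornerClosure] at h
  obtain ⟨_, ⟨a, rfl⟩, hd⟩ := Metric.mem_closure_iff.1 h 1 one_pos
  rw [dist_eq_norm] at hd
  obtain ⟨v, hv⟩ := (isUnit_one_sub_of_norm_lt_one hd).exists_right_inv
  refine ⟨a * w * v, ?_⟩
  rw [sub_sub_cancel] at hv
  rw [← hv]
  noncomm_ring

variable [PartialOrder A] [StarOrderedRing A]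

/-- The resolvent `u = δ (w + δ)⁻¹` and the complement `1 - u = w (w + δ)⁻¹`, which serves as an
approximate unit of the closure of `w A w`. -/
theorem exists_resolvent {w : A} (hw : 0 ≤ w) {δ : ℝ} (hδ : 0 < δ) :
    ∃ u c : A, IsSelfAdjoint u ∧ ‖u‖ ≤ 1 ∧ ‖u * w * u‖ ≤ δ ∧ 1 - u = w * c ∧ 1 - u = c * w := by
  have hsp : ∀ x ∈ spectrum ℝ w, 0 ≤ x := fun x hx => spectrum_nonneg_of_nonneg hw hx
  have hne : ∀ x ∈ spectrum ℝ w, x + δ ≠ 0 := fun x hx => by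
    have := hsp x hx
    positivity
  have hsa : IsSelfAdjoint w := .of_nonneg hw
  have hcont : ContinuousOn (fun x : ℝ => δ / (x + δ)) (spectrum ℝ w) := by
    fun_prop (disch := assumption)
  have hcont' : ContinuousOn (fun x : ℝ => 1 / (x + δ)) (spectrum ℝ w) := by
    fun_prop (disch := assumption)
  have hid : cfc (fun x : ℝ => x) w = w := cfc_id' ℝ w
  have hu : 1 - cfc (fun x : ℝ => δ / (x + δ)) w = cfc (fun x : ℝ => 1 - δ / (x + δ)) w := by
    rw [cfc_sub (fun _ => 1) _ w, cfc_const_one ℝ w]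
  refine ⟨cfc (fun x : ℝ => δ / (x + δ)) w, cfc (fun x : ℝ => 1 / (x + δ)) w,
    cfc_predicate _ w, ?_, ?_, ?_, ?_⟩
  · refine norm_cfc_le zero_le_one fun x hx => ?_
    have := hsp x hx
    rw [Real.norm_of_nonneg (by positivity), div_le_one (by positivity)]
    linarith
  · have : cfc (fun x : ℝ => δ / (x + δ)) w * w * cfc (fun x : ℝ => δ / (x + δ)) w
        = cfc (fun x : ℝ => δ / (x + δ) * x * (δ / (x + δ))) w := by
      rw [cfc_mul (fun x : ℝ => δ / (x + δ) * x) _ w, cfc_mul _ (fun x : ℝ => x) w, hid]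
    rw [this]
    refine norm_cfc_le hδ.le fun x hx => ?_
    have hx0 := hsp x hx
    rw [Real.norm_of_nonneg (by positivity)]
    have h1 : δ / (x + δ) ≤ 1 := by
      rw [div_le_one (by positivity)]
      linarith
    have h2 : δ / (x + δ) * x ≤ δ := by
      rw [div_mul_eq_mul_div, div_le_iff₀ (by positivity)]
      nlinarith
    calc δ / (x + δ) * x * (δ / (x + δ)) ≤ δ * 1 := by gcongr
      _ = δ := mul_one δ
  · rw [hu]
    nth_rw 2 [← hid]
    rw [← cfc_mul (fun x : ℝ => x) _ w]
    refine cfc_congr fun x hx => ?_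
    have := hne x hx
    field_simp
    ring
  · rw [hu]
    nth_rw 3 [← hid]
    rw [← cfc_mul _ (fun x : ℝ => x) w]
    refine cfc_congr fun x hx => ?_
    have := hne x hx
    field_simp
    ring

/-- Conjugating `a* a ≤ ε + n w` with `u` bounds `(a u)* (a u)`. -/
theorem norm_mul_sq_le {w a u : A} {ε δ n : ℝ} (hε : 0 ≤ ε) (hn : 0 ≤ n)
    (h : star a * a ≤ ε • (1 : A) + n • w) (hu : IsSelfAdjoint u) (hu1 : ‖u‖ ≤ 1)
    (huw : ‖u * w * u‖ ≤ δ) : ‖a * u‖ ^ 2 ≤ ε + n * δ := by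
  have h1 : star (a * u) * (a * u) = u * (star a * a) * u := by
    rw [star_mul, hu.star_eq]
    noncomm_ring
  have h2 : u * (star a * a) * u ≤ u * (ε • (1 : A) + n • w) * u := hu.conjugate_le_conjugate h
  have h3 : u * (ε • (1 : A) + n • w) * u = ε • (u * u) + n • (u * w * u) := by
    simp only [mul_add, add_mul, mul_smul_comm, smul_mul_assoc, mul_one]
  calc ‖a * u‖ ^ 2 = ‖star (a * u) * (a * u)‖ := by rw [CStarRing.norm_star_mul_self, sq]
    _ ≤ ‖ε • (u * u) + n • (u * w * u)‖ := by
        rw [← h3]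
        refine CStarAlgebra.norm_le_norm_of_nonneg_of_le (star_mul_self_nonneg _) ?_
        rw [h1]
        exact h2
    _ ≤ ε * (‖u‖ * ‖u‖) + n * ‖u * w * u‖ := by
        refine (norm_add_le _ _).trans ?_
        rw [norm_smul, norm_smul, Real.norm_of_nonneg hε, Real.norm_of_nonneg hn]
        gcongr
        exact norm_mul_le u u
    _ ≤ ε * (1 * 1) + n * δ := by gcongr
    _ = ε + n * δ := by ring

theorem mem_cornerClosure_of_forall_state {w : A} (hw : 0 ≤ w) (hsa : IsSelfAdjoint w) {a : A}
    (ha : ∀ ω : stateSpace A, ω.1 w = 0 → a ∈ stateHereditary ω) : a ∈ cornerClosure w hsa := by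
  rw [mem_cornerClosure, Metric.mem_closure_iff]
  intro η hη
  -- `‖a u‖` and `‖a* u‖` below are at most `√(2 ε) = η / 4`
  set ε : ℝ := η ^ 2 / 32 with hεdef
  have hε : 0 < ε := by positivity
  obtain ⟨n, hn, han⟩ := exists_le_smul_one_add_smul hw (.star_mul_self a)
    (fun ω hω => (ha ω hω).2) hε
  obtain ⟨m, hm, ham⟩ := exists_le_smul_one_add_smul hw (.star_mul_self (star a))
    (fun ω hω => (ha ω hω).1) hε
  -- one `δ` serves both bounds: `n δ ≤ ε` and `m δ ≤ ε`
  set δ : ℝ := ε / (n + m + 1) with hδdef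
  have hδ : 0 < δ := by positivity
  have hδ' : (n + m + 1) * δ = ε := by
    rw [hδdef]
    field_simp
  obtain ⟨u, c, hu, hu1, huw, h1, h2⟩ := exists_resolvent hw hδ
  have hau : ‖a * u‖ ≤ η / 4 := by
    have h := norm_mul_sq_le hε.le hn han hu hu1 huw
    refine abs_le_of_sq_le_sq' ?_ (by positivity) |>.2
    nlinarith [mul_nonneg hm hδ.le]
  have hua : ‖u * a‖ ≤ η / 4 := by
    have h := norm_mul_sq_le hε.le hm ham hu hu1 huw
    rw [← norm_star, star_mul, hu.star_eq]
    refine abs_le_of_sq_le_sq' ?_ (by positivity) |>.2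
    nlinarith [mul_nonneg hn hδ.le]
  refine ⟨w * (c * a * c) * w, ⟨_, rfl⟩, ?_⟩
  have h3 : w * (c * a * c) * w = (1 - u) * a * (1 - u) := by
    nth_rw 1 [h1]
    rw [h2]
    noncomm_ring
  have h4 : a - (1 - u) * a * (1 - u) = a * u + u * a - u * (a * u) := by noncomm_ring
  rw [dist_eq_norm, h3, h4]
  calc ‖a * u + u * a - u * (a * u)‖ ≤ ‖a * u‖ + ‖u * a‖ + ‖u‖ * ‖a * u‖ :=
        (norm_sub_le _ _).trans (add_le_add (norm_add_le _ _) (norm_mul_le _ _))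
    _ ≤ η / 4 + η / 4 + 1 * (η / 4) := by gcongr
    _ < η := by linarith

theorem cornerClosure_le_stateHereditary {w : A} (hw : 0 ≤ w) (hsa : IsSelfAdjoint w)
    {ω : stateSpace A} (hω : ω.1 w = 0) : cornerClosure w hsa ≤ stateHereditary ω := by
  intro x hx
  rw [mem_cornerClosure] at hx
  refine closure_minimal ?_ (isClosed_stateHereditary ω) hx
  have hker := mem_leftKernel_of_nonneg hw hω
  rintro _ ⟨a, rfl⟩
  refine ⟨?_, (leftKernel ω).mul_mem_left _ hker⟩
  rw [star_mul, star_mul, hsa.star_eq, ← mul_assoc]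
  exact (leftKernel ω).mul_mem_left _ hker

theorem cornerClosure_eq_iInter {w : A} (hw : 0 ≤ w) (hsa : IsSelfAdjoint w) :
    (cornerClosure w hsa : Set A) =
      ⋂ ω ∈ {ω : stateSpace A | ω.1 w = 0}, (stateHereditary ω : Set A) := by
  refine Set.Subset.antisymm ?_ fun a ha => ?_
  · exact Set.subset_iInter₂ fun ω hω => cornerClosure_le_stateHereditary hw hsa hω
  · exact mem_cornerClosure_of_forall_state hw hsa fun ω hω => Set.mem_iInter₂.1 ha ω hω

theorem isHereditaryCStarSubalgebra_cornerClosure {w : A} (hw : 0 ≤ w) (hsa : IsSelfAdjoint w) :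
    IsHereditaryCStarSubalgebra (cornerClosure w hsa) := by
  refine ⟨isClosed_closure, fun a b ha hab hb => ?_⟩
  refine mem_cornerClosure_of_forall_state hw hsa fun ω hω => ?_
  exact (isHereditaryCStarSubalgebra_stateHereditary ω).2 a b ha hab
    (cornerClosure_le_stateHereditary hw hsa hω hb)

end Corner

/-! ### Dyadic sums of increasing projections -/

section DyadicSum

variable {A : Type*} [CStarAlgebra A] {q : ℕ → A}

theorem summable_half_pow_smul (hq : ∀ m, IsStarProjection (q m)) :
    Summable fun m : ℕ => ((1 / 2 : ℝ) ^ (m + 1)) • q m := by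
  have hg : Summable fun m : ℕ => (1 / 2 : ℝ) ^ (m + 1) :=
    (summable_nat_add_iff 1).2 summable_geometric_two
  refine Summable.of_norm_bounded hg fun m => ?_
  rw [norm_smul, Real.norm_of_nonneg (by positivity)]
  exact mul_le_of_le_one_right (by positivity) ((hq m).norm_le)

/-- The sum `w` has no right inverse: its partial sums `s_m` satisfy `(1 - q_m) s_m = 0`, so that
`‖(1 - q_m) w‖ → 0`, although the projections `1 - q_m` have norm `1`. -/
theorem tsum_half_pow_smul_mul_ne_one (hq : ∀ m, IsStarProjection (q m)) (hne : ∀ m, q m ≠ 1)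
    (hmul : ∀ k m, k ≤ m → q m * q k = q k) (c : A) :
    (∑' m : ℕ, ((1 / 2 : ℝ) ^ (m + 1)) • q m) * c ≠ 1 := by
  set w : A := ∑' m : ℕ, ((1 / 2 : ℝ) ^ (m + 1)) • q m
  intro hc
  let s : ℕ → A := fun m => ∑ k ∈ Finset.range m, ((1 / 2 : ℝ) ^ (k + 1)) • q k
  have hs : Filter.Tendsto (fun m => ‖w - s m‖ * ‖c‖) Filter.atTop (nhds 0) := by
    have h1 : Filter.Tendsto s Filter.atTop (nhds w) :=
      (summable_half_pow_smul hq).hasSum.tendsto_sum_nat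
    have h2 := ((tendsto_const_nhds (x := w)).sub h1).norm.mul_const ‖c‖
    simpa using h2
  have hbound : ∀ m, 1 ≤ ‖w - s m‖ * ‖c‖ := by
    intro m
    have hq' : IsStarProjection (1 - q m) := (hq m).one_sub
    have hq0 : 1 - q m ≠ 0 := sub_ne_zero.2 (hne m).symm
    have hq1 : ‖1 - q m‖ = 1 := by
      have h1 := CStarRing.norm_star_mul_self (x := 1 - q m)
      rw [hq'.isSelfAdjoint.star_eq, hq'.isIdempotentElem.eq] at h1
      exact (mul_eq_left₀ (norm_ne_zero_iff.2 hq0)).1 h1.symm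
    have hqs : (1 - q m) * s m = 0 := by
      simp only [s]
      rw [Finset.mul_sum]
      refine Finset.sum_eq_zero fun k hk => ?_
      rw [mul_smul_comm, sub_mul, one_mul, hmul k m (Finset.mem_range.1 hk).le, sub_self, smul_zero]
    have h1 : (1 - q m) * ((w - s m) * c) = 1 - q m := by
      rw [← mul_assoc, mul_sub (1 - q m), hqs, sub_zero, mul_assoc, hc, mul_one]
    calc (1 : ℝ) = ‖(1 - q m) * ((w - s m) * c)‖ := by rw [h1, hq1]
      _ ≤ ‖1 - q m‖ * (‖w - s m‖ * ‖c‖) :=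
          (norm_mul_le _ _).trans (by gcongr; exact norm_mul_le _ _)
      _ = _ := by rw [hq1, one_mul]
  exact absurd (ge_of_tendsto' hs hbound) (by norm_num)

variable [PartialOrder A] [StarOrderedRing A]

theorem half_pow_smul_nonneg (hq : ∀ m, IsStarProjection (q m)) (m : ℕ) :
    0 ≤ ((1 / 2 : ℝ) ^ (m + 1)) • q m :=
  smul_nonneg (by positivity) (hq m).nonneg

theorem tsum_half_pow_smul_nonneg (hq : ∀ m, IsStarProjection (q m)) :
    0 ≤ ∑' m : ℕ, ((1 / 2 : ℝ) ^ (m + 1)) • q m :=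
  tsum_nonneg (half_pow_smul_nonneg hq)

theorem apply_tsum_half_pow_smul_eq_zero_iff (hq : ∀ m, IsStarProjection (q m))
    (ω : stateSpace A) :
    ω.1 (∑' m : ℕ, ((1 / 2 : ℝ) ^ (m + 1)) • q m) = 0 ↔ ∀ m, ω.1 (q m) = 0 := by
  have hsum := summable_half_pow_smul hq
  constructor
  · intro h m
    have h1 := apply_eq_zero_of_le (half_pow_smul_nonneg hq m)
      (hsum.le_tsum m fun k _ => half_pow_smul_nonneg hq k) h
    rw [← Complex.coe_smul, map_smul, smul_eq_mul] at h1
    exact (mul_eq_zero.1 h1).resolve_left (by norm_num)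
  · intro h
    rw [ω.1.map_tsum hsum]
    refine (tsum_congr fun m => ?_).trans tsum_zero
    rw [← Complex.coe_smul, map_smul, h m, smul_zero]

theorem apply_eq_zero_of_mul_eq_left {ω : stateSpace A} {e f : A} (he : IsStarProjection e)
    (hf : IsStarProjection f) (hef : e * f = e) (h : ω.1 f = 0) : ω.1 e = 0 :=
  apply_eq_zero_of_le he.nonneg ((he.le_iff_mul_eq_left hf).2 hef) h

theorem IsStarProjection.mem_stateHereditary_iff {ω : stateSpace A} {e : A}
    (he : IsStarProjection e) : e ∈ stateHereditary ω ↔ ω.1 e = 0 :=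
  mem_stateHereditary_iff_of_nonneg he.nonneg

end DyadicSum

/-! ### Ground states of a frustration-free system -/

namespace FrustrationFreeSystem

variable {G : Type*} {d : ℕ} (p : FrustrationFreeSystem G d) {Λ : ℕ → Finset G}

variable (Λ) in
theorem weight_nonneg : 0 ≤ p.weight Λ :=
  tsum_half_pow_smul_nonneg fun m => p.isStarProjection (Λ m)

theorem exists_subset_of_cover (hmono : Monotone Λ) (hcover : ∀ g : G, ∃ m, g ∈ Λ m)
    (S : Finset G) : ∃ m, S ⊆ Λ m := by
  choose k hk using hcover
  exact ⟨S.sup k, fun g hg => hmono (Finset.le_sup hg) (hk g)⟩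

theorem mem_groundStates_iff (hmono : Monotone Λ) (hcover : ∀ g : G, ∃ m, g ∈ Λ m)
    (ω : stateSpace (SpinAlgebra G d)) : ω ∈ p.groundStates ↔ ω.1 (p.weight Λ) = 0 := by
  refine Iff.trans ⟨fun h m => h (Λ m), fun h S => ?_⟩
    (apply_tsum_half_pow_smul_eq_zero_iff (fun m => p.isStarProjection (Λ m)) ω).symm
  obtain ⟨m, hm⟩ := exists_subset_of_cover hmono hcover S
  exact apply_eq_zero_of_mul_eq_left (p.isStarProjection S) (p.isStarProjection (Λ m))
    (p.mul_left_eq _ _ hm) (h m)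

theorem weight_mul_ne_one (hp : p.IsProper) (hmono : Monotone Λ) (c : SpinAlgebra G d) :
    p.weight Λ * c ≠ 1 :=
  tsum_half_pow_smul_mul_ne_one (fun m => p.isStarProjection (Λ m)) (fun m => (hp (Λ m)).ne)
    (fun _ _ h => p.mul_right_eq _ _ (hmono h)) c

theorem hereditary_eq_iInter (hmono : Monotone Λ) (hcover : ∀ g : G, ∃ m, g ∈ Λ m) :
    (p.hereditary Λ : Set (SpinAlgebra G d)) =
      ⋂ ω ∈ p.groundStates, (stateHereditary ω : Set (SpinAlgebra G d)) := by
  have h : p.groundStates = {ω | ω.1 (p.weight Λ) = 0} :=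
    Set.ext fun ω => p.mem_groundStates_iff hmono hcover ω
  rw [h]
  exact cornerClosure_eq_iInter (p.weight_nonneg Λ) _

/-- A state `ω` is a ground state if and only if its `B_ω` contains the hereditary subalgebra, because
the projections `p_Λ` lie in the latter. -/
theorem hereditary_le_stateHereditary_iff (hmono : Monotone Λ) (hcover : ∀ g : G, ∃ m, g ∈ Λ m)
    (ω : stateSpace (SpinAlgebra G d)) :
    p.hereditary Λ ≤ stateHereditary ω ↔ ω ∈ p.groundStates := by
  constructor
  · intro h S
    have hS : p.proj S ∈ (p.hereditary Λ : Set (SpinAlgebra G d)) := by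
      rw [p.hereditary_eq_iInter hmono hcover]
      refine Set.mem_iInter₂.2 fun φ hφ => ?_
      exact (p.isStarProjection S).mem_stateHereditary_iff.2 (hφ S)
    exact (p.isStarProjection S).mem_stateHereditary_iff.1 (h hS)
  · intro hω
    exact cornerClosure_le_stateHereditary (p.weight_nonneg Λ) _
      ((p.mem_groundStates_iff hmono hcover ω).1 hω)

/-- The associated pure states are covered by the supports of any set of ground states that
contains the pure ones. -/
theorem pureStatesOf_hereditary_eq_iUnion (hmono : Monotone Λ)
    (hcover : ∀ g : G, ∃ m, g ∈ Λ m) {S : Set (stateSpace (SpinAlgebra G d))}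
    (hS : S ⊆ p.groundStates)
    (hpure : ∀ ω ∈ p.groundStates, ω.1 ∈ pureStates (SpinAlgebra G d) → ω ∈ S) :
    pureStatesOf (p.hereditary Λ) = ⋃ ω ∈ S, stateSupport ω := by
  ext ψ
  rw [Set.mem_iUnion₂]
  constructor
  · rintro ⟨hψ, hle⟩
    exact ⟨⟨ψ, pureStates_subset_stateSpace hψ⟩,
      hpure _ ((p.hereditary_le_stateHereditary_iff hmono hcover _).1 hle) hψ, hψ, le_rfl⟩
  · rintro ⟨ω, hω, hψ, hle⟩
    exact ⟨hψ, ((p.hereditary_le_stateHereditary_iff hmono hcover ω).2 (hS hω)).trans hle⟩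

end FrustrationFreeSystem

theorem mainTheorem3 {G : Type*} [Group G] [Group.FG G] (d : ℕ) [NeZero d]
    (p : FrustrationFreeSystem G d) (hp : p.IsProper)
    (Λ : ℕ → Finset G) (hmono : Monotone Λ) (hcover : ∀ g : G, ∃ m, g ∈ Λ m) :
    (IsHereditaryCStarSubalgebra (p.hereditary Λ) ∧ (p.hereditary Λ : Set (SpinAlgebra G d)) ≠ Set.univ) ∧
    (p.hereditary Λ : Set (SpinAlgebra G d)) =
      ⋂ ω ∈ p.groundStates, (stateHereditary ω : Set (SpinAlgebra G d)) ∧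
    pureStatesOf (p.hereditary Λ) = ⋃ ω ∈ p.groundStates, stateSupport ω ∧
    pureStatesOf (p.hereditary Λ) =
      ⋃ ω ∈ {ω ∈ p.groundStates | ω.1 ∈ pureStates (SpinAlgebra G d)}, stateSupport ω := by
  refine ⟨⟨isHereditaryCStarSubalgebra_cornerClosure (p.weight_nonneg Λ) _, fun h => ?_⟩,
    p.hereditary_eq_iInter hmono hcover,
    p.pureStatesOf_hereditary_eq_iUnion hmono hcover subset_rfl fun ω hω _ => hω,
    p.pureStatesOf_hereditary_eq_iUnion hmono hcover (Set.sep_subset _ _) fun ω hω hψ => ⟨hω, hψ⟩⟩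
  have h1 : (1 : SpinAlgebra G d) ∈ (p.hereditary Λ : Set (SpinAlgebra G d)) := h ▸ Set.mem_univ _
  obtain ⟨c, hc⟩ := exists_mul_eq_one_of_one_mem_cornerClosure h1
  exact p.weight_mul_ne_one hp hmono c hc
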